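/- A \emph{Pisot number} is a real algebraic integer greater than $1$ whose Galois conjugates over $\mathbb{Q}$ other than itself all have absolute value less than $1$. A \emph{Salem number} is a real algebraic integer greater than $1$ whose Galois conjugates over $\mathbb{Q}$ other than itself all have absolute value at most $1$, at least one of them having absolute value exactly $1$. For an algebraic number $\alpha$, let $\overline{|\alpha|}$ (the house of $\alpha$) denote the maximal absolute value of the Galois conjugates of $\alpha$ over $\mathbb{Q}$ (including $\alpha$ itself). Let $q$ be a Pisot or Salem number, and let $(a(n))_{n=1}^{\infty}$ be a sequence of algebraic integers of $\mathbb{Q}(q)$ such that $a(n)\ge 0$ for all $n\ge 1$ and $a(n)\neq 0$ for infinitely many $n$. Let $n_1<n_2<\cdots$ be the indices $n\ge1$ with $a(n)\ne0$, listed in increasing order. Suppose that \[ \limsup_{k\to\infty}\overline{|a(n_k)|}^{\,1/n_k}<q \] and that there exists a positive integer $\ell$ such that \[ \limsup_{k\to\infty}\frac{n_k}{k^{\ell}\log Q(n_k)}=\infty, \qquad\text{where } Q(x):=\max\Bigl(x,\max_{1\le m\le x}\overline{|a(m)|}\Bigr). \] Then the series $\sum_{n=1}^{\infty}a(n)/q^{n}$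 converges, and its sum is either transcendental or algebraic over $\mathbb{Q}(q)$ of degree at least $\ell+1$. -/

import Mathlib

/-- The Galois conjugates over `ℚ` of a real number `α`, as complex numbers: the complex roots of
its minimal polynomial over `ℚ` (used for algebraic `α` only). -/
noncomputable def galoisConjugates (α : ℝ) : Set ℂ :=
  (minpoly ℚ α).rootSet ℂ

/-- A Pisot number: a real algebraic integer greater than `1` all of whose Galois conjugates over
`ℚ` other than itself have absolute value less than `1`. -/
def IsPisotNumber (q : ℝ) : Prop :=
  1 < q ∧ IsIntegral ℤ q ∧ ∀ z ∈ galoisConjugates q, z ≠ (q : ℂ) → ‖z‖ < 1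

/-- A Salem number: a real algebraic integer greater than `1` all of whose Galois conjugates over
`ℚ` other than itself have absolute value at most `1`, with equality for at least one of them. -/
def IsSalemNumber (q : ℝ) : Prop :=
  1 < q ∧ IsIntegral ℤ q ∧ (∀ z ∈ galoisConjugates q, z ≠ (q : ℂ) → ‖z‖ ≤ 1) ∧
    ∃ z ∈ galoisConjugates q, z ≠ (q : ℂ) ∧ ‖z‖ = 1

/-- The house of a real algebraic number: the maximal absolute value of its Galois conjugates
over `ℚ` (for algebraic `α` the supremum is over a finite non-empty set). -/
noncomputable def algebraicHouse (α : ℝ) : ℝ :=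
  sSup ((fun z : ℂ => ‖z‖) '' galoisConjugates α)

/-- On a number field inside `ℝ`, `algebraicHouse` is Mathlib's `NumberField.house`. -/
theorem algebraicHouse_eq_house (K : IntermediateField ℚ ℝ) [NumberField K] (α : K) :
    algebraicHouse (α : ℝ) = NumberField.house α := by
  have h1 : galoisConjugates (α : ℝ) = Set.range fun φ : K →+* ℂ => φ α := by
    have h0 : minpoly ℚ (α : ℝ) = minpoly ℚ α :=
      minpoly.algebraMap_eq (algebraMap K ℝ).injective α
    rw [NumberField.Embeddings.range_eval_eq_rootSet_minpoly K ℂ α, galoisConjugates, h0]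
  unfold algebraicHouse
  rw [h1]
  refine IsLUB.csSup_eq ⟨?_, fun b hb => ?_⟩ ((Set.range_nonempty _).image _)
  · rintro _ ⟨_, ⟨φ, rfl⟩, rfl⟩
    exact NumberField.norm_embedding_le_house α φ
  · have hb' : ∀ φ : K →+* ℂ, ‖φ α‖ ≤ b := fun φ => hb ⟨_, ⟨φ, rfl⟩, rfl⟩
    have hb0 : 0 ≤ b := (norm_nonneg _).trans (hb' (Classical.arbitrary _))
    exact (pi_norm_le_iff_of_nonneg hb0).2 hb'

/-- The set of indices `n ≥ 1` with `a n ≠ 0`. The value `a 0` is never used. -/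
def nonzeroIndices (a : ℕ → ℝ) : Set ℕ :=
  {n | 1 ≤ n ∧ a n ≠ 0}

/-- `max (N, max_{1 ≤ m ≤ N} house (a m))`. -/
noncomputable def houseMax (a : ℕ → ℝ) (N : ℕ) : ℝ :=
  (insert (N : ℝ) ((Finset.Icc 1 N).image fun m => algebraicHouse (a m))).max'
    (Finset.insert_nonempty _ _)

/-! Suppose the sum is algebraic over K = ℚ(q) of degree D ≤ ℓ. Adjoin a digit 1 at index 0, let
A(X) be the digit series, P a monic polynomial of degree D over K with P(A(1/q)) = 0, and f(m) the
coefficients of P(A(X)). The tails y(R) = ∑_{m>R} f(m) q^(R-m) satisfy y(R+1) = q y(R) - f(R+1), and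
P(A(1/q)) = 0 makes them finite sums in K with a bounded denominator. Let H ≥ N bound the conjugates
of the digits up to N. As q has no other conjugate outside the unit disc, the other conjugates of
y(R) are at most a power of H, so a nonzero |y(R)| is at least a power of 1/H
(`le_abs_of_isIntegral_mul`). For R up to a fixed proportion of N it is also at most a power of H
(`abs_polyTail_le_of_mul_le`). Hence a nonzero tail cannot be multiplied by q for W = O(log H) steps
in a row.

Digits are nonnegative, so off the support of A^(D-1) the number f(m) is the coefficient of A^D,
positive exactly on the support of A^D. In a long gap of the support of A^(D-1) after u, a digit
index s gives f(u+s) > 0, which forces y > 0 on [u, u+s); a Liouville inequality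
(`exists_ne_zero_between`) provides s comparable to the gap. But each positive tail needs a point of
the support of A^D among the last W indices. Counting (`card_le_of_recurrence`) gives N = O(k^D log
H) with k nonzero digits up to N (`exists_le_card_pow_mul_log`), against the sparsity hypothesis. -/

section Counting

/-! ### Sign and counting arguments for the recurrence -/

variable {Q δ Γ : ℝ} {f y : ℕ → ℝ} {S S₁ S₂ : Set ℕ} {W M L₀ c : ℕ}

theorem recurrence_le_pow_mul (hQ : 1 < Q) (hrec : ∀ R, y (R + 1) = Q * y R - f (R + 1)) {R t : ℕ}
    (hf : ∀ m, R < m → m ≤ R + t → 0 ≤ f m) : y (R + t) ≤ Q ^ t * y R := by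
  induction t with
  | zero => simp
  | succ t ih =>
    have h1 := ih fun m h h' => hf m h (by omega)
    have h2 := hf (R + t + 1) (by omega) (by omega)
    rw [← add_assoc, hrec, pow_succ]
    nlinarith

theorem recurrence_eq_pow_mul (hrec : ∀ R, y (R + 1) = Q * y R - f (R + 1)) {R t : ℕ}
    (hf : ∀ m, R < m → m ≤ R + t → f m = 0) : y (R + t) = Q ^ t * y R := by
  induction t with
  | zero => simp
  | succ t ih =>
    have h1 := ih fun m h h' => hf m h (by omega)
    have h2 := hf (R + t + 1) (by omega) (by omega)
    rw [← add_assoc, hrec, pow_succ, h1, h2]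
    ring

/-- A negative value is at most -δ; subtracting nonnegative terms only lowers it, so W steps take it
below -Γ. -/
theorem recurrence_nonneg (hQ : 1 < Q) (hrec : ∀ R, y (R + 1) = Q * y R - f (R + 1))
    (hlow : ∀ R ≤ M, y R ≠ 0 → δ ≤ |y R|) (hup : ∀ R ≤ M, |y R| ≤ Γ) (hΓ : Γ < δ * Q ^ W) {R : ℕ}
    (hR : R + W ≤ M) (hf : ∀ m, R < m → m ≤ R + W → 0 ≤ f m) : 0 ≤ y R := by
  by_contra! hneg
  have h1 := hlow R (by omega) hneg.ne
  rw [abs_of_neg hneg] at h1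
  have h2 := recurrence_le_pow_mul hQ hrec hf
  have h3 := (abs_le.1 (hup _ hR)).1
  have h4 : 0 < Q ^ W := by positivity
  nlinarith

/-- Positivity travels backwards: the value at v is nonnegative, so the one before is at least f v /
Q, and earlier values dominate it up to powers of Q. -/
theorem recurrence_pos (hQ : 1 < Q) (hrec : ∀ R, y (R + 1) = Q * y R - f (R + 1))
    (hlow : ∀ R ≤ M, y R ≠ 0 → δ ≤ |y R|) (hup : ∀ R ≤ M, |y R| ≤ Γ) (hΓ : Γ < δ * Q ^ W) {R v : ℕ}
    (hRv : R < v) (hv : v + W ≤ M) (hf : ∀ m, R < m → m ≤ v + W → 0 ≤ f m) (hfv : 0 < f v) :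
    0 < y R := by
  have h1 : 0 ≤ y v := recurrence_nonneg hQ hrec hlow hup hΓ hv fun m h h' => hf m (by omega) h'
  obtain ⟨t, rfl⟩ : ∃ t, v = R + t + 1 := ⟨v - R - 1, by omega⟩
  rw [hrec] at h1
  have h2 : y (R + t) ≤ Q ^ t * y R :=
    recurrence_le_pow_mul hQ hrec fun m h h' => hf m h (by omega)
  have h3 : 0 < Q ^ t := by positivity
  have h4 : 0 < y (R + t) := by nlinarith
  exact pos_of_mul_pos_right (h4.trans_le h2) h3.le

/-- Otherwise a value of at least δ would have been multiplied by Q at each of the last W steps,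
exceeding Γ. -/
theorem exists_support_of_recurrence_pos (hrec : ∀ R, y (R + 1) = Q * y R - f (R + 1)) (hQ : 1 < Q)
    (hlow : ∀ R ≤ M, y R ≠ 0 → δ ≤ |y R|) (hup : ∀ R ≤ M, |y R| ≤ Γ) (hΓ : Γ < δ * Q ^ W) {R : ℕ}
    (hR : R ≤ M) (hW : W ≤ R) (hy : 0 < y R) : ∃ m, R < m + W ∧ m ≤ R ∧ f m ≠ 0 := by
  by_contra! hcon
  obtain ⟨t, rfl⟩ : ∃ t, R = t + W := ⟨R - W, by omega⟩
  have h1 := recurrence_eq_pow_mul hrec (R := t) (t := W) fun m h h' => hcon m (by omega) h'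
  have h3 : 0 < Q ^ W := by positivity
  have h4 : 0 < y t := by
    rw [h1] at hy
    exact pos_of_mul_pos_right hy h3.le
  have h5 := hlow t (by omega) h4.ne'
  rw [abs_of_pos h4] at h5
  have h6 := (abs_le.1 (hup _ hR)).2
  nlinarith

open Classical in
/-- If `y (R + 1) = Q y R - f (R + 1)`, where the nonzero values of `y` are bounded below by `δ`
and above by `Γ`, then `f` cannot vanish too often, given the additive structure of its support. -/
theorem card_le_of_recurrence (hQ : 1 < Q) (hrec : ∀ R, y (R + 1) = Q * y R - f (R + 1))
    (hlow : ∀ R ≤ M, y R ≠ 0 → δ ≤ |y R|) (hup : ∀ R ≤ M, |y R| ≤ Γ) (hΓ : Γ < δ * Q ^ W)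
    (h0 : 0 ∈ S₁) (hpos : ∀ m ∈ S₂, m ∉ S₁ → 0 < f m) (hzero : ∀ m ∉ S₂, f m = 0)
    (hadd : ∀ u ∈ S₁, ∀ s ∈ S, u + s ∈ S₂) (hS : ∀ L ≥ L₀, ∃ s ∈ S, s ≤ L ∧ L ≤ c * s)
    (hL₀ : 1 ≤ L₀) :
    M + 1 ≤ c * (W * ((Finset.range (M + 1)).filter (· ∈ S₂)).card + W) +
      (W + L₀ + 1) * ((Finset.range (M + 1)).filter (· ∈ S₁)).card := by
  set G := (Finset.range (M + 1)).filter (0 < y ·) with hG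
  set T := (Finset.range (M + 1)).filter (· ∈ S₂) with hT
  set U := (Finset.range (M + 1)).filter (· ∈ S₁) with hU
  have hnn : ∀ m ∉ S₁, 0 ≤ f m := fun m hm => by
    by_cases h : m ∈ S₂
    · exact (hpos m h hm).le
    · exact (hzero m h).ge
  have hGcard : G.card ≤ W * T.card + W := by
    have hsub : G ⊆ (T ×ˢ Finset.range W).image (fun x => x.1 + x.2) ∪ Finset.range W := by
      intro R hR
      obtain ⟨hRM, hyR⟩ := Finset.mem_filter.1 hR
      rw [Finset.mem_range] at hRM
      rw [Finset.mem_union, Finset.mem_image, Finset.mem_range]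
      by_cases hW : W ≤ R
      · left
        obtain ⟨m, h1, h2, h3⟩ :=
          exists_support_of_recurrence_pos hrec hQ hlow hup hΓ (by omega) hW hyR
        refine ⟨(m, R - m), ?_, by simp only; omega⟩
        simp only [hT, Finset.mem_product, Finset.mem_filter, Finset.mem_range]
        refine ⟨⟨by omega, ?_⟩, by omega⟩
        by_contra h
        exact h3 (hzero m h)
      · right; omega
    calc G.card ≤ _ := Finset.card_le_card hsub
      _ ≤ _ := Finset.card_union_le _ _
      _ ≤ T.card * W + W := by
        gcongr
        · exact Finset.card_image_le.trans (by simp)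
        · simp
      _ = _ := by ring
  -- The fibres of `g` are the gaps of S₁, each with its left endpoint.
  let g : ℕ → ℕ := fun R => Nat.findGreatest (· ∈ S₁) R
  have hg : ∀ R, g R ∈ S₁ := fun R =>
    Nat.findGreatest_spec (P := (· ∈ S₁)) (Nat.zero_le R) h0
  have hgle : ∀ R, g R ≤ R := fun R => Nat.findGreatest_le R
  have hgmax : ∀ R m, m ≤ R → g R < m → m ∉ S₁ := fun R m h h' =>
    Nat.findGreatest_is_greatest h' h
  have hmaps : ∀ R ∈ Finset.range (M + 1), g R ∈ U := by
    intro R hR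
    rw [Finset.mem_range] at hR
    simp only [hU, Finset.mem_filter, Finset.mem_range]
    exact ⟨by have := hgle R; omega, hg R⟩
  have hfib : ∀ u ∈ U, ((Finset.range (M + 1)).filter (g · = u)).card ≤
      c * (G.filter (g · = u)).card + (W + L₀ + 1) := by
    intro u hu
    obtain ⟨huM, huS⟩ := Finset.mem_filter.1 hu
    set F := (Finset.range (M + 1)).filter (g · = u) with hF
    rcases F.eq_empty_or_nonempty with hE | hE
    · simp [hE]
    set w := F.max' hE with hw
    obtain ⟨hwM, hwu⟩ := Finset.mem_filter.1 (F.max'_mem hE)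
    rw [Finset.mem_range, ← hw] at hwM
    rw [← hw] at hwu
    have hFle : F.card ≤ w + 1 - u := by
      have : F ⊆ Finset.Icc u w := fun R hR => by
        have := hgle R
        rw [(Finset.mem_filter.1 hR).2] at this
        exact Finset.mem_Icc.2 ⟨this, F.le_max' R hR⟩
      simpa using Finset.card_le_card this
    by_cases hlen : w < u + W + L₀
    · omega
    -- The margin W keeps the window after u + s, needed for positivity at u + s, inside the gap.
    obtain ⟨s, hs, hs1, hs2⟩ := hS (w - u - W) (by omega)
    have hspos : 0 < s := Nat.pos_of_ne_zero fun h => by subst h; omega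
    have hnot : ∀ m, u < m → m ≤ w → m ∉ S₁ := fun m h h' => hgmax w m h' (by omega)
    have hsub : Finset.Ico u (u + s) ⊆ G.filter (g · = u) := by
      intro R hR
      rw [Finset.mem_Ico] at hR
      simp only [hG, Finset.mem_filter, Finset.mem_range]
      refine ⟨⟨by omega, ?_⟩, ?_⟩
      · exact recurrence_pos hQ hrec hlow hup hΓ hR.2 (by omega)
          (fun m h h' => hnn m (hnot m (by omega) (by omega)))
          (hpos _ (hadd u huS s hs) (hnot _ (by omega) (by omega)))
      · have h1 : u ≤ g R := Nat.le_findGreatest hR.1 huS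
        by_contra hne
        exact hnot (g R) (by omega) (by have := hgle R; omega) (hg R)
    have hcard := Finset.card_le_card hsub
    simp only [Nat.card_Ico, add_tsub_cancel_left] at hcard
    have := Nat.mul_le_mul_left c hcard
    omega
  have hsum : (Finset.range (M + 1)).card = _ := Finset.card_eq_sum_card_fiberwise hmaps
  have hsumG : G.card = _ := Finset.card_eq_sum_card_fiberwise (f := g) (t := U) (s := G)
    fun R hR => hmaps R (Finset.filter_subset _ _ hR)
  rw [Finset.card_range] at hsum
  calc M + 1 = _ := hsum
    _ ≤ ∑ u ∈ U, (c * (G.filter (g · = u)).card + (W + L₀ + 1)) := Finset.sum_le_sum hfib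
    _ = c * G.card + (W + L₀ + 1) * U.card := by
      rw [Finset.sum_add_distrib, ← Finset.mul_sum, ← hsumG, Finset.sum_const, smul_eq_mul,
        mul_comm U.card]
    _ ≤ _ := by gcongr

end Counting

/-! ### Denominators and norms -/

open Polynomial in
theorem exists_int_mul_coeff_isIntegral {K : Type*} [Field K] [NumberField K] (P : K[X]) :
    ∃ b : ℤ, b ≠ 0 ∧ ∀ j, IsIntegral ℤ ((b : K) * P.coeff j) := by
  classical
  have : Algebra.IsAlgebraic ℤ K := by
    have := IsFractionRing.comap_isAlgebraic_iff (A := ℤ) (K := ℚ) (C := K)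
    exact this.2 inferInstance
  obtain ⟨b, hb, h⟩ :=
    Algebra.IsAlgebraic.exists_integral_multiples ℤ (P.support.image P.coeff)
  refine ⟨b, hb, fun j => ?_⟩
  by_cases hj : j ∈ P.support
  · simpa using h _ (Finset.mem_image_of_mem _ hj)
  · rw [notMem_support_iff.1 hj, mul_zero]
    exact isIntegral_zero

/-- A nonzero algebraic integer is not small if its conjugates other than the given real one are
bounded. -/
theorem one_le_abs_mul_pow_of_isIntegral {K : Type*} [Field K] [NumberField K] (σ : K →+* ℝ)
    {x : K} (hx : IsIntegral ℤ x) (hx0 : x ≠ 0) {B : ℝ} (hB : 1 ≤ B)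
    (h : ∀ φ : K →+* ℂ, φ ≠ Complex.ofRealHom.comp σ → ‖φ x‖ ≤ B) :
    1 ≤ |σ x| * B ^ Module.finrank ℚ K := by
  classical
  -- The norm is a nonzero rational integer, so the product of all conjugates has absolute value at
  -- least 1.
  have hintegral := Algebra.isIntegral_norm ℚ hx
  obtain ⟨z, hz⟩ := IsIntegrallyClosed.isIntegral_iff.1 hintegral
  have hnorm := Algebra.norm_eq_prod_embeddings ℚ ℂ x
  have hz0 : z ≠ 0 := by
    rintro rfl
    rw [map_zero] at hz
    exact hx0 (Algebra.norm_eq_zero_iff.1 hz.symm)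
  have h1 : (1 : ℝ) ≤ ‖∏ φ : K →ₐ[ℚ] ℂ, φ x‖ := by
    rw [← hnorm, ← hz]
    have : (1 : ℝ) ≤ |(z : ℝ)| := by exact_mod_cast Int.one_le_abs hz0
    simpa using this
  rw [norm_prod] at h1
  let φ₀ : K →ₐ[ℚ] ℂ := (Complex.ofRealHom.comp σ).toRatAlgHom
  rw [← Finset.mul_prod_erase _ _ (Finset.mem_univ φ₀)] at h1
  have h2 : ‖φ₀ x‖ = |σ x| := by simp [φ₀]
  have h3 : ∏ φ ∈ Finset.univ.erase φ₀, ‖φ x‖ ≤ B ^ Module.finrank ℚ K := by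
    calc _ ≤ ∏ φ ∈ Finset.univ.erase φ₀, B := by
          refine Finset.prod_le_prod (fun _ _ => norm_nonneg _) fun φ hφ => h φ.toRingHom ?_
          intro he
          refine (Finset.mem_erase.1 hφ).1 (AlgHom.ext fun y => ?_)
          exact congrArg (fun ψ : K →+* ℂ => ψ y) he
      _ = B ^ (Finset.univ.erase φ₀).card := by simp
      _ ≤ _ := by
        refine pow_le_pow_right₀ hB ?_
        rw [← AlgHom.card ℚ K ℂ]
        exact Finset.card_le_univ _
  rw [h2] at h1
  exact h1.trans (by gcongr)

/-! ### Coefficients and supports of powers of the digit series -/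

section PowerCoefficients

open PowerSeries

variable {K : Type*} [Field K]

theorem isIntegral_coeff_mk_pow {a : ℕ → K} (ha : ∀ m, IsIntegral ℤ (a m)) (j m : ℕ) :
    IsIntegral ℤ (coeff m (mk a ^ j)) := by
  induction j generalizing m with
  | zero =>
    rw [pow_zero, coeff_one]
    split_ifs
    · exact isIntegral_one
    · exact isIntegral_zero
  | succ j ih =>
    rw [pow_succ, coeff_mul]
    refine IsIntegral.sum _ fun x _ => (ih _).mul ?_
    rw [coeff_mk]
    exact ha _

theorem norm_coeff_mk_pow_le (φ : K →+* ℂ) {a : ℕ → K} {N : ℕ} {H : ℝ} (hH : 0 ≤ H)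
    (h : ∀ i ≤ N, ‖φ (a i)‖ ≤ H) (j : ℕ) {m : ℕ} (hm : m ≤ N) :
    ‖φ (coeff m (mk a ^ j))‖ ≤ ((N + 1) * H) ^ j := by
  induction j generalizing m with
  | zero =>
    rw [pow_zero, coeff_one, pow_zero]
    split_ifs <;> simp
  | succ j ih =>
    rw [pow_succ, coeff_mul, map_sum]
    calc _ ≤ ∑ x ∈ Finset.HasAntidiagonal.antidiagonal m, ((N + 1) * H) ^ j * H := by
          refine (norm_sum_le _ _).trans (Finset.sum_le_sum fun x hx => ?_)
          rw [Finset.HasAntidiagonal.mem_antidiagonal] at hx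
          rw [map_mul, norm_mul, coeff_mk]
          gcongr
          · exact ih (by omega)
          · exact h _ (by omega)
      _ = (m + 1) * (((N + 1) * H) ^ j * H) := by simp
      _ ≤ (N + 1) * (((N + 1) * H) ^ j * H) := by gcongr
      _ = _ := by ring

variable {σ : K →+* ℝ} {a : ℕ → K}

theorem coeff_mk_pow_nonneg (ha : ∀ m, 0 ≤ σ (a m)) (j m : ℕ) :
    0 ≤ σ (coeff m (mk a ^ j)) := by
  induction j generalizing m with
  | zero =>
    rw [pow_zero, coeff_one]
    split_ifs <;> simp
  | succ j ih =>
    rw [pow_succ, coeff_mul, map_sum]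
    refine Finset.sum_nonneg fun x _ => ?_
    rw [map_mul, coeff_mk]
    exact mul_nonneg (ih _) (ha _)

theorem hasSum_coeff_mk_pow (ha : ∀ m, 0 ≤ σ (a m)) {r x : ℝ} (hr : 0 < r)
    (hx : HasSum (fun m => σ (a m) / r ^ m) x) (j : ℕ) :
    HasSum (fun m => σ (coeff m (mk a ^ j)) / r ^ m) (x ^ j) := by
  induction j with
  | zero =>
    convert! hasSum_ite_eq 0 (1 : ℝ) using 2 with m
    rw [pow_zero, coeff_one]
    split_ifs with h <;> simp [h]
  | succ j ih =>
    have hf : Summable fun m => ‖σ (coeff m (mk a ^ j)) / r ^ m‖ := by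
      refine ih.summable.congr fun m => ?_
      rw [Real.norm_of_nonneg (div_nonneg (coeff_mk_pow_nonneg ha j m) (by positivity))]
    have hg : Summable fun m => ‖σ (a m) / r ^ m‖ := by
      refine hx.summable.congr fun m => ?_
      rw [Real.norm_of_nonneg (div_nonneg (ha m) (by positivity))]
    have hs := (summable_norm_sum_mul_antidiagonal_of_summable_norm hf hg).of_norm.hasSum
    rw [← tsum_mul_tsum_eq_tsum_sum_antidiagonal_of_summable_norm hf hg, ih.tsum_eq,
      hx.tsum_eq] at hs
    rw [pow_succ]
    convert! hs using 2 with m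
    rw [coeff_mul, map_sum, Finset.sum_div]
    refine Finset.sum_congr rfl fun p hp => ?_
    rw [Finset.HasAntidiagonal.mem_antidiagonal] at hp
    rw [map_mul, coeff_mk, ← hp, pow_add, mul_div_mul_comm]

/-- Nonnegativity rules out cancellation, so supports add. -/
theorem coeff_mk_pow_succ_ne_zero (ha : ∀ m, 0 ≤ σ (a m)) {j u s : ℕ}
    (hu : coeff u (mk a ^ j) ≠ 0) (hs : a s ≠ 0) : coeff (u + s) (mk a ^ (j + 1)) ≠ 0 := by
  have h1 : 0 < σ (coeff (u + s) (mk a ^ (j + 1))) := by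
    rw [pow_succ, coeff_mul, map_sum]
    have hu' : 0 < σ (coeff u (mk a ^ j)) :=
      (coeff_mk_pow_nonneg ha j u).lt_of_ne' (by simpa using hu)
    have hs' : 0 < σ (a s) := (ha s).lt_of_ne' (by simpa using hs)
    refine Finset.sum_pos' (fun x _ => ?_) ⟨(u, s), by simp, ?_⟩
    · rw [map_mul, coeff_mk]
      exact mul_nonneg (coeff_mk_pow_nonneg ha _ _) (ha _)
    · rw [map_mul, coeff_mk]
      exact mul_pos hu' hs'
  intro h
  simp [h] at h1

/-- With a nonzero digit at index 0 the supports of the powers are nested; this is why that digit is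
adjoined. -/
theorem coeff_mk_pow_ne_zero_of_le (ha : ∀ m, 0 ≤ σ (a m)) (h0 : a 0 ≠ 0) {i j m : ℕ} (hij : i ≤ j)
    (hm : coeff m (mk a ^ i) ≠ 0) : coeff m (mk a ^ j) ≠ 0 := by
  induction j, hij using Nat.le_induction with
  | base => exact hm
  | succ j _ ih =>
    have := coeff_mk_pow_succ_ne_zero (s := 0) ha ih h0
    rwa [add_zero] at this

open Classical in
theorem card_support_mk_pow_le (a : ℕ → K) (j N : ℕ) :
    ((Finset.range N).filter fun m => coeff m (mk a ^ j) ≠ 0).card ≤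
      ((Finset.range N).filter fun m => a m ≠ 0).card ^ j := by
  induction j with
  | zero =>
    rw [pow_zero, pow_zero]
    refine Finset.card_le_one.2 fun x hx y hy => ?_
    simp only [Finset.mem_filter, coeff_one, ne_eq, ite_eq_right_iff, Classical.not_imp] at hx hy
    omega
  | succ j ih =>
    set T := (Finset.range N).filter fun m => coeff m (mk a ^ j) ≠ 0
    set S := (Finset.range N).filter fun m => a m ≠ 0
    have hsub : ((Finset.range N).filter fun m => coeff m (mk a ^ (j + 1)) ≠ 0) ⊆
        (T ×ˢ S).image fun x => x.1 + x.2 := by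
      intro m hm
      obtain ⟨hmN, hm0⟩ := Finset.mem_filter.1 hm
      rw [Finset.mem_range] at hmN
      rw [pow_succ, coeff_mul] at hm0
      obtain ⟨x, hx, hx0⟩ := Finset.exists_ne_zero_of_sum_ne_zero hm0
      rw [Finset.HasAntidiagonal.mem_antidiagonal] at hx
      rw [coeff_mk] at hx0
      refine Finset.mem_image.2 ⟨x, ?_, hx⟩
      simp only [T, S, Finset.mem_product, Finset.mem_filter, Finset.mem_range]
      exact ⟨⟨by omega, left_ne_zero_of_mul hx0⟩, by omega, right_ne_zero_of_mul hx0⟩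
    calc _ ≤ _ := Finset.card_le_card hsub
      _ ≤ _ := Finset.card_image_le
      _ = T.card * S.card := Finset.card_product _ _
      _ ≤ S.card ^ j * S.card := by gcongr
      _ = _ := (pow_succ _ _).symm

end PowerCoefficients

/-! ### Tails of the polynomial in the digit series -/

section PolynomialTail

theorem abs_sub_sum_range_le_of_hasSum {g : ℕ → ℝ} {C r Q s : ℝ} (hr : 0 < r) (hrQ : r < Q)
    (hg : ∀ m, |g m| ≤ C * r ^ m) (hs : HasSum (fun m => g m / Q ^ m) s) (N : ℕ) :
    |s - ∑ m ∈ Finset.range N, g m / Q ^ m| ≤ C * (1 - r / Q)⁻¹ * (r / Q) ^ N := by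
  have hQ : 0 < Q := hr.trans hrQ
  have h1 := (hasSum_nat_add_iff' N).2 hs
  have h2 : HasSum (fun i : ℕ => C * (r / Q) ^ N * (r / Q) ^ i) (C * (r / Q) ^ N * (1 - r / Q)⁻¹) :=
    (hasSum_geometric_of_lt_one (by positivity) ((div_lt_one hQ).2 hrQ)).mul_left _
  have h3 := h1.norm_le_of_bounded h2 fun i => by
    rw [norm_div, Real.norm_eq_abs, Real.norm_of_nonneg (by positivity : 0 ≤ Q ^ (i + N))]
    calc _ ≤ C * r ^ (i + N) / Q ^ (i + N) := by gcongr; exact hg _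
      _ = _ := by rw [mul_div_assoc, ← div_pow, pow_add]; ring
  rw [Real.norm_eq_abs] at h3
  calc _ ≤ _ := h3
    _ = _ := by ring

/-- Run backwards, the recurrence contracts by Q at each step, so one late value controls the
earlier ones. -/
theorem pow_mul_abs_recurrence_le {Q B : ℝ} {f y : ℕ → ℝ} (hQ : 1 < Q)
    (hrec : ∀ R, y (R + 1) = Q * y R - f (R + 1)) {R t : ℕ} (hB : 0 ≤ B)
    (hf : ∀ m, m ≤ R + t → |f m| ≤ B) : Q ^ t * |y R| ≤ Q ^ t * (t * B) + |y (R + t)| := by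
  induction t with
  | zero => simp
  | succ t ih =>
    have h1 := ih fun m h => hf m (by omega)
    have h2 := hf (R + t + 1) (by omega)
    have h3 : Q * |y (R + t)| ≤ |y (R + t + 1)| + |f (R + t + 1)| := by
      rw [← abs_of_pos (by positivity : 0 < Q), ← abs_mul]
      have : Q * y (R + t) = y (R + t + 1) + f (R + t + 1) := by rw [hrec]; ring
      rw [this]
      exact abs_add_le _ _
    have h4 : 1 ≤ Q ^ (t + 1) := one_le_pow₀ hQ.le
    rw [← add_assoc]
    push_cast
    calc Q ^ (t + 1) * |y R| = Q * (Q ^ t * |y R|) := by ring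
      _ ≤ Q * (Q ^ t * (t * B) + |y (R + t)|) := by gcongr
      _ = Q ^ (t + 1) * (t * B) + Q * |y (R + t)| := by ring
      _ ≤ Q ^ (t + 1) * (t * B) + (|y (R + t + 1)| + 1 * B) := by linarith
      _ ≤ Q ^ (t + 1) * (t * B) + (|y (R + t + 1)| + Q ^ (t + 1) * B) := by gcongr
      _ = _ := by ring

open Polynomial

variable {K : Type*} [Field K]

/-- The coefficient of index `m` of `P (∑ a n X ^ n)`. -/
noncomputable def polyCoeff (P : K[X]) (a : ℕ → K) (m : ℕ) : K :=
  ∑ j ∈ Finset.range (P.natDegree + 1), P.coeff j * PowerSeries.coeff m (PowerSeries.mk a ^ j)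

/-- If `P (∑ a n / q ^ n) = 0`, this is `∑ q ^ (R - m) * polyCoeff P a m` over `m > R`. -/
noncomputable def polyTail (q : K) (P : K[X]) (a : ℕ → K) (R : ℕ) : K :=
  -∑ m ∈ Finset.range (R + 1), polyCoeff P a m * q ^ (R - m)

/-- A common bound for the sums of the absolute values of the conjugates of the coefficients. -/
noncomputable def coeffBound [NumberField K] (P : K[X]) : ℝ :=
  1 + ∑ φ : K →+* ℂ, ∑ j ∈ Finset.range (P.natDegree + 1), ‖φ (P.coeff j)‖

theorem one_le_coeffBound [NumberField K] (P : K[X]) : 1 ≤ coeffBound P :=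
  le_add_of_nonneg_right (by positivity)

theorem sum_norm_coeff_le_coeffBound [NumberField K] (P : K[X]) (φ : K →+* ℂ) :
    ∑ j ∈ Finset.range (P.natDegree + 1), ‖φ (P.coeff j)‖ ≤ coeffBound P := by
  have := Finset.single_le_sum
    (f := fun φ : K →+* ℂ => ∑ j ∈ Finset.range (P.natDegree + 1), ‖φ (P.coeff j)‖)
    (fun _ _ => by positivity) (Finset.mem_univ φ)
  exact this.trans (by rw [coeffBound]; linarith)

theorem polyTail_succ (q : K) (P : K[X]) (a : ℕ → K) (R : ℕ) :
    polyTail q P a (R + 1) = q * polyTail q P a R - polyCoeff P a (R + 1) := by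
  rw [polyTail, polyTail, Finset.sum_range_succ, mul_neg, Finset.mul_sum, neg_add, Nat.sub_self,
    pow_zero, mul_one, ← sub_eq_add_neg]
  congr 2
  refine Finset.sum_congr rfl fun m hm => ?_
  rw [Finset.mem_range] at hm
  rw [show R + 1 - m = R - m + 1 by omega, pow_succ]
  ring

theorem isIntegral_mul_polyTail {q : K} {P : K[X]} {a : ℕ → K} {b : ℤ} (hq : IsIntegral ℤ q)
    (ha : ∀ m, IsIntegral ℤ (a m)) (hb : ∀ j, IsIntegral ℤ ((b : K) * P.coeff j)) (R : ℕ) :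
    IsIntegral ℤ ((b : K) * polyTail q P a R) := by
  rw [polyTail, mul_neg, Finset.mul_sum]
  refine (IsIntegral.sum _ fun m _ => ?_).neg
  rw [← mul_assoc, polyCoeff, Finset.mul_sum]
  refine (IsIntegral.sum _ fun j _ => ?_).mul (hq.pow _)
  rw [← mul_assoc]
  exact (hb j).mul (isIntegral_coeff_mk_pow ha j m)

theorem norm_sum_coeff_mul_le [NumberField K] (P : K[X]) (φ : K →+* ℂ) {B : ℝ} (hB : 1 ≤ B)
    {u : ℕ → K} (hu : ∀ j, ‖φ (u j)‖ ≤ B ^ j) :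
    ‖φ (∑ j ∈ Finset.range (P.natDegree + 1), P.coeff j * u j)‖ ≤
      coeffBound P * B ^ P.natDegree := by
  rw [map_sum]
  calc _ ≤ ∑ j ∈ Finset.range (P.natDegree + 1), ‖φ (P.coeff j)‖ * B ^ P.natDegree := by
        refine (norm_sum_le _ _).trans (Finset.sum_le_sum fun j hj => ?_)
        rw [map_mul, norm_mul]
        gcongr
        exact (hu j).trans (pow_le_pow_right₀ hB (by simpa [Nat.lt_succ_iff] using hj))
    _ ≤ _ := by
      rw [← Finset.sum_mul]
      gcongr
      exact sum_norm_coeff_le_coeffBound P φ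

theorem norm_polyCoeff_le [NumberField K] (P : K[X]) (φ : K →+* ℂ) {a : ℕ → K} {N : ℕ} {H : ℝ}
    (hH : 1 ≤ H) (h : ∀ i ≤ N, ‖φ (a i)‖ ≤ H) {m : ℕ} (hm : m ≤ N) :
    ‖φ (polyCoeff P a m)‖ ≤ coeffBound P * ((N + 1) * H) ^ P.natDegree := by
  refine norm_sum_coeff_mul_le P φ ?_ fun j =>
    norm_coeff_mk_pow_le φ (by positivity) h j hm
  nlinarith [Nat.cast_nonneg (α := ℝ) N]

/-- The finite form of the tail is what embeds in ℂ; powers of a conjugate in the closed unit disc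
cost nothing. -/
theorem norm_polyTail_le [NumberField K] (P : K[X]) (φ : K →+* ℂ) {q : K} (hq : ‖φ q‖ ≤ 1)
    {a : ℕ → K} {N : ℕ} {H : ℝ}
    (hH : 1 ≤ H) (h : ∀ i ≤ N, ‖φ (a i)‖ ≤ H) {R : ℕ} (hR : R ≤ N) :
    ‖φ (polyTail q P a R)‖ ≤ (N + 1) * (coeffBound P * ((N + 1) * H) ^ P.natDegree) := by
  have hP := one_le_coeffBound P
  rw [polyTail, map_neg, norm_neg, map_sum]
  calc _ ≤ ∑ m ∈ Finset.range (R + 1), coeffBound P * ((N + 1) * H) ^ P.natDegree := by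
        refine (norm_sum_le _ _).trans (Finset.sum_le_sum fun m hm => ?_)
        rw [Finset.mem_range] at hm
        rw [map_mul, norm_mul, map_pow, norm_pow]
        calc _ ≤ coeffBound P * ((N + 1) * H) ^ P.natDegree * 1 := by
              gcongr
              · exact norm_polyCoeff_le P φ hH h (by omega)
              · exact pow_le_one₀ (norm_nonneg _) hq
          _ = _ := mul_one _
    _ = (R + 1) * (coeffBound P * ((N + 1) * H) ^ P.natDegree) := by simp
    _ ≤ _ := by gcongr

section Analytic

variable {σ : K →+* ℝ} {a : ℕ → K}

theorem hasSum_polyCoeff (P : K[X]) (ha : ∀ m, 0 ≤ σ (a m)) {Q ξ : ℝ} (hQ : 0 < Q)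
    (hξ : HasSum (fun m => σ (a m) / Q ^ m) ξ) :
    HasSum (fun m => σ (polyCoeff P a m) / Q ^ m) (P.eval₂ σ ξ) := by
  rw [eval₂_eq_sum_range]
  have := hasSum_sum (s := Finset.range (P.natDegree + 1)) fun j _ =>
    (hasSum_coeff_mk_pow ha hQ hξ j).mul_left (σ (P.coeff j))
  convert! this using 2 with m
  rw [polyCoeff, map_sum, Finset.sum_div]
  exact Finset.sum_congr rfl fun j _ => by rw [map_mul, mul_div_assoc]

/-- A term of a convergent nonnegative series is at most its sum, here the j-th power of the sum at
1/r. -/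
theorem exists_abs_polyCoeff_le (P : K[X]) (ha : ∀ m, 0 ≤ σ (a m)) {r : ℝ} (hr : 0 < r)
    (hs : Summable (fun m => σ (a m) / r ^ m)) :
    ∃ C : ℝ, 0 ≤ C ∧ ∀ m, |σ (polyCoeff P a m)| ≤ C * r ^ m := by
  obtain ⟨x, hx⟩ := hs
  have hx0 : 0 ≤ x := hx.nonneg fun m => div_nonneg (ha m) (by positivity)
  refine ⟨∑ j ∈ Finset.range (P.natDegree + 1), |σ (P.coeff j)| * x ^ j, by positivity,
    fun m => ?_⟩
  rw [polyCoeff, map_sum, Finset.sum_mul]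
  refine (Finset.abs_sum_le_sum_abs _ _).trans (Finset.sum_le_sum fun j _ => ?_)
  have h0 := coeff_mk_pow_nonneg ha j
  rw [map_mul, abs_mul, mul_assoc, abs_of_nonneg (h0 m)]
  gcongr
  rw [← div_le_iff₀ (by positivity)]
  exact le_hasSum (hasSum_coeff_mk_pow ha hr hx j) m fun i _ => div_nonneg (h0 i) (by positivity)

/-- Since P vanishes at ξ, minus the partial sum is the remainder of a series dominated by a
geometric one. -/
theorem exists_abs_polyTail_le {P : K[X]} {q : K} (ha : ∀ m, 0 ≤ σ (a m)) {r ξ : ℝ} (hr : 0 < r)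
    (hrq : r < σ q) (hs : Summable (fun m => σ (a m) / r ^ m))
    (hξ : HasSum (fun m => σ (a m) / σ q ^ m) ξ) (hP : P.eval₂ σ ξ = 0) :
    ∃ C : ℝ, 0 ≤ C ∧ ∀ R, |σ (polyTail q P a R)| ≤ C * r ^ R := by
  obtain ⟨C, hC0, hC⟩ := exists_abs_polyCoeff_le P ha hr hs
  have hq : 0 < σ q := hr.trans hrq
  have hsum := hasSum_polyCoeff P ha hq hξ
  rw [hP] at hsum
  have h1 : 0 < 1 - r / σ q := by rw [sub_pos, div_lt_one hq]; exact hrq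
  refine ⟨C * (1 - r / σ q)⁻¹, by positivity, fun R => ?_⟩
  have h2 := abs_sub_sum_range_le_of_hasSum hr hrq hC hsum (R + 1)
  have h3 : σ (polyTail q P a R) = σ q ^ R *
      (0 - ∑ m ∈ Finset.range (R + 1), σ (polyCoeff P a m) / σ q ^ m) := by
    rw [polyTail, map_neg, map_sum, zero_sub, mul_neg, Finset.mul_sum]
    congr 1
    refine Finset.sum_congr rfl fun m hm => ?_
    rw [Finset.mem_range] at hm
    rw [map_mul, map_pow, pow_sub₀ _ hq.ne' (by omega)]
    field_simp
  rw [h3, abs_mul, abs_of_pos (by positivity)]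
  calc _ ≤ σ q ^ R * (C * (1 - r / σ q)⁻¹ * (r / σ q) ^ (R + 1)) := by gcongr
    _ ≤ σ q ^ R * (C * (1 - r / σ q)⁻¹ * (r / σ q) ^ R) := by
      gcongr ?_ * (_ * ?_)
      exact pow_le_pow_of_le_one (by positivity) ((div_lt_one hq).2 hrq).le (by omega)
    _ = _ := by rw [div_pow]; field_simp

end Analytic

end PolynomialTail

/-! ### Liouville inequality and gaps between nonzero digits -/

section Liouville

open Polynomial

variable {K : Type*} [Field K] {σ : K →+* ℝ} {a : ℕ → K} {q : K}

/-- The real truncations are eventually not roots of a polynomial that vanishes at the limit. -/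
theorem eventually_eval₂_ne_zero {P : K[X]} (hP0 : P ≠ 0) {x : ℕ → ℝ} {ξ : ℝ}
    (hx : Filter.Tendsto x Filter.atTop (nhds ξ)) (hne : ∀ n, x n ≠ ξ) :
    ∀ᶠ n in Filter.atTop, P.eval₂ σ (x n) ≠ 0 := by
  have hP' : P.map σ ≠ 0 := (Polynomial.map_ne_zero_iff σ.injective).2 hP0
  have hfin : ({t | (P.map σ).IsRoot t} \ {ξ}).Finite :=
    (Polynomial.finite_setOfPred_isRoot hP').subset Set.sdiff_subset
  have hmem : ({t | (P.map σ).IsRoot t} \ {ξ})ᶜ ∈ nhds ξ :=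
    hfin.isClosed.isOpen_compl.mem_nhds (by simp)
  filter_upwards [hx hmem] with n hn h
  exact hn ⟨by simpa [IsRoot, eval_map] using h, hne n⟩

theorem exists_abs_eval₂_le {P : K[X]} {ξ : ℝ} (hP : P.eval₂ σ ξ = 0) :
    ∃ L : ℝ, 0 ≤ L ∧ ∀ t ∈ Set.Icc 0 ξ, |P.eval₂ σ t| ≤ L * |ξ - t| := by
  have hroot : (P.map σ).IsRoot ξ := by simpa [IsRoot, eval_map] using hP
  obtain ⟨R, hR⟩ := dvd_iff_isRoot.2 hroot
  obtain ⟨L, hL⟩ := (isCompact_Icc (a := (0 : ℝ)) (b := ξ)).exists_bound_of_continuousOn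
    (f := fun t => R.eval t) R.continuous.continuousOn
  refine ⟨max L 0, le_max_right _ _, fun t ht => ?_⟩
  have h1 : P.eval₂ σ t = (t - ξ) * R.eval t := by
    rw [← eval_map, hR]; simp
  rw [h1, abs_mul, mul_comm, abs_sub_comm]
  gcongr
  exact (hL t ht).trans (le_max_left _ _)

/-- The numerator `q ^ (D x) P (∑ a m / q ^ m)` for the truncation at `x`. -/
noncomputable def truncNumerator (q : K) (P : K[X]) (a : ℕ → K) (x : ℕ) : K :=
  ∑ j ∈ Finset.range (P.natDegree + 1), P.coeff j *
    ((∑ m ∈ Finset.range (x + 1), a m * q ^ (x - m)) ^ j * q ^ ((P.natDegree - j) * x))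

theorem isIntegral_mul_truncNumerator {P : K[X]} {b : ℤ} (hq : IsIntegral ℤ q)
    (ha : ∀ m, IsIntegral ℤ (a m)) (hb : ∀ j, IsIntegral ℤ ((b : K) * P.coeff j)) (x : ℕ) :
    IsIntegral ℤ ((b : K) * truncNumerator q P a x) := by
  rw [truncNumerator, Finset.mul_sum]
  refine IsIntegral.sum _ fun j _ => ?_
  rw [← mul_assoc]
  exact (hb j).mul (((IsIntegral.sum _ fun m _ => (ha m).mul (hq.pow _)).pow _).mul (hq.pow _))

theorem map_truncNumerator (P : K[X]) (hq : σ q ≠ 0) (x : ℕ) :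
    σ (truncNumerator q P a x) = σ q ^ (P.natDegree * x) *
      P.eval₂ σ (∑ m ∈ Finset.range (x + 1), σ (a m) / σ q ^ m) := by
  rw [truncNumerator, map_sum, eval₂_eq_sum_range, Finset.mul_sum]
  refine Finset.sum_congr rfl fun j hj => ?_
  have hj' : j ≤ P.natDegree := by simpa [Nat.lt_succ_iff] using hj
  have h1 : σ (∑ m ∈ Finset.range (x + 1), a m * q ^ (x - m)) =
      σ q ^ x * ∑ m ∈ Finset.range (x + 1), σ (a m) / σ q ^ m := by
    rw [map_sum, Finset.mul_sum]
    refine Finset.sum_congr rfl fun m hm => ?_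
    rw [Finset.mem_range] at hm
    rw [map_mul, map_pow, pow_sub₀ _ hq (by omega)]
    field_simp
  rw [map_mul, map_mul, map_pow, map_pow, h1, mul_pow, ← pow_mul]
  have h2 : P.natDegree * x = x * j + (P.natDegree - j) * x := by
    rw [mul_comm x j, ← add_mul]; congr 1; omega
  rw [h2, pow_add]
  ring

variable [NumberField K]

/-- The lower bound for a nonzero `x` with denominator `b`. -/
theorem le_abs_of_isIntegral_mul {x : K} {b : ℤ} (hb : b ≠ 0) (hx : IsIntegral ℤ ((b : K) * x))
    (hx0 : x ≠ 0) {B : ℝ} (hB : 1 ≤ B)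
    (h : ∀ φ : K →+* ℂ, φ ≠ Complex.ofRealHom.comp σ → ‖φ x‖ ≤ B) :
    (|(b : ℝ)| * (|(b : ℝ)| * B) ^ Module.finrank ℚ K)⁻¹ ≤ |σ x| := by
  have hb1 : (1 : ℝ) ≤ |(b : ℝ)| := by exact_mod_cast Int.one_le_abs hb
  have h1 := one_le_abs_mul_pow_of_isIntegral σ hx (mul_ne_zero (by exact_mod_cast hb) hx0)
    (B := |(b : ℝ)| * B) (by nlinarith) fun φ hφ => by
      rw [map_mul, norm_mul, map_intCast, Complex.norm_intCast]
      gcongr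
      exact h φ hφ
  rw [map_mul, abs_mul, map_intCast] at h1
  rw [inv_le_iff_one_le_mul₀ (by positivity)]
  linarith

theorem norm_truncNumerator_le (P : K[X]) (φ : K →+* ℂ) (hq : ‖φ q‖ ≤ 1) {C r : ℝ} (hC : 1 ≤ C)
    (hr : 1 ≤ r) (h : ∀ m, ‖φ (a m)‖ ≤ C * r ^ m) (x : ℕ) :
    ‖φ (truncNumerator q P a x)‖ ≤ coeffBound P * (C * (2 * r) ^ x) ^ P.natDegree := by
  have h1 : ‖φ (∑ m ∈ Finset.range (x + 1), a m * q ^ (x - m))‖ ≤ C * (2 * r) ^ x := by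
    rw [map_sum]
    calc _ ≤ ∑ m ∈ Finset.range (x + 1), C * r ^ x := by
          refine (norm_sum_le _ _).trans (Finset.sum_le_sum fun m hm => ?_)
          rw [Finset.mem_range] at hm
          rw [map_mul, norm_mul, map_pow, norm_pow, ← mul_one (C * r ^ x)]
          gcongr
          · exact (h m).trans (by gcongr; omega)
          · exact pow_le_one₀ (norm_nonneg _) hq
      _ = ((x + 1 : ℕ) : ℝ) * (C * r ^ x) := by simp
      -- The number of terms is absorbed into the exponential, whence the base 2 r.
      _ ≤ ((2 ^ x : ℕ) : ℝ) * (C * r ^ x) := by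
        gcongr
        exact Nat.lt_two_pow_self
      _ = _ := by push_cast; rw [mul_pow]; ring
  refine norm_sum_coeff_mul_le P φ ?_ fun j => ?_
  · have : 1 ≤ (2 * r) ^ x := one_le_pow₀ (by linarith)
    nlinarith
  · rw [map_mul, norm_mul, map_pow, norm_pow, map_pow, norm_pow,
      ← mul_one ((C * (2 * r) ^ x) ^ j)]
    gcongr
    exact pow_le_one₀ (norm_nonneg _) hq

/-- A Liouville type inequality: the support of the digits of an algebraic number has no long
multiplicative gaps. -/
theorem exists_ne_zero_between (hq : 1 < σ q) (hqi : IsIntegral ℤ q)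
    (hqc : ∀ φ : K →+* ℂ, φ ≠ Complex.ofRealHom.comp σ → ‖φ q‖ ≤ 1)
    (hai : ∀ m, IsIntegral ℤ (a m)) (ha : ∀ m, 0 ≤ σ (a m)) (hinf : {m | a m ≠ 0}.Infinite)
    {C r : ℝ} (hC : 1 ≤ C) (hr : 1 ≤ r) (hrq : r < σ q)
    (hh : ∀ φ : K →+* ℂ, ∀ m, ‖φ (a m)‖ ≤ C * r ^ m) {ξ : ℝ}
    (hξ : HasSum (fun m => σ (a m) / σ q ^ m) ξ) {P : K[X]} (hP0 : P ≠ 0)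
    (hP : P.eval₂ σ ξ = 0) :
    ∃ c x₀ : ℕ, 1 ≤ c ∧ ∀ x ≥ x₀, ∃ y, x < y ∧ y ≤ c * x ∧ a y ≠ 0 := by
  obtain ⟨b, hb, hbi⟩ := exists_int_mul_coeff_isIntegral P
  obtain ⟨L, hL0, hL⟩ := exists_abs_eval₂_le hP
  set d := Module.finrank ℚ K
  set D := P.natDegree
  set Q := σ q with hQ
  have hQ0 : 0 < Q := by positivity
  have hρ1 : r / Q < 1 := (div_lt_one hQ0).2 hrq
  have hρ0 : 0 < r / Q := by positivity
  have hCP := one_le_coeffBound P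
  -- E is the exponential rate of the scaling q ^ (D x) times the conjugate bounds, and A collects
  -- the constants; c makes the tail factor (r / Q) ^ c outweigh E by 2.
  set E : ℝ := Q ^ D * (2 * r) ^ (D * d) with hE
  have hE0 : 0 < E := by positivity
  set A : ℝ := |(b : ℝ)| * (|(b : ℝ)| * (coeffBound P * C ^ D)) ^ d * (L * (C * (1 - r / Q)⁻¹))
    with hA
  obtain ⟨c, hc⟩ := exists_pow_lt_of_lt_one (by positivity : 0 < (2 * E)⁻¹) hρ1
  have hpt : ∀ m, σ (a m) / Q ^ m ≥ 0 := fun m => div_nonneg (ha m) (by positivity)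
  -- Infinitely many positive digits keep truncations strictly below ξ, so eventually they avoid the
  -- finitely many other roots.
  have hlt : ∀ n, ∑ m ∈ Finset.range (n + 1), σ (a m) / Q ^ m < ξ := fun n => by
    obtain ⟨m, hm, hnm⟩ := hinf.exists_gt n
    have hpos : 0 < σ (a m) / Q ^ m :=
      div_pos ((ha m).lt_of_ne' (by simpa using hm)) (by positivity)
    have h1 : ∑ i ∈ Finset.range (m + 1), σ (a i) / Q ^ i ≤ ξ :=
      sum_le_hasSum _ (fun i _ => hpt i) hξ
    rw [Finset.sum_range_succ] at h1
    have h2 : ∑ i ∈ Finset.range (n + 1), σ (a i) / Q ^ i ≤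
        ∑ i ∈ Finset.range m, σ (a i) / Q ^ i :=
      Finset.sum_le_sum_of_subset_of_nonneg (Finset.range_subset_range.2 hnm) fun i _ _ => hpt i
    linarith
  have hne := eventually_eval₂_ne_zero (σ := σ) hP0
    (hξ.tendsto_sum_nat.comp (Filter.tendsto_add_atTop_nat 1)) fun n => (hlt n).ne
  have hsmall : ∀ᶠ x : ℕ in Filter.atTop, A * (1 / 2 : ℝ) ^ x < 1 := by
    have := (tendsto_pow_atTop_nhds_zero_of_lt_one (by norm_num : (0 : ℝ) ≤ 1 / 2)
      (by norm_num)).const_mul A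
    rw [mul_zero] at this
    exact this.eventually_lt_const one_pos
  obtain ⟨x₀, hx₀⟩ := Filter.eventually_atTop.1 (hne.and hsmall)
  refine ⟨c + 1, x₀, by omega, fun x hx => ?_⟩
  obtain ⟨hx1, hx2⟩ := hx₀ x hx
  by_contra! hcon
  set t := ∑ m ∈ Finset.range (x + 1), σ (a m) / Q ^ m with ht
  -- Without digits in (x, (c + 1) x] the truncation at x is also the one at (c + 1) x.
  have htail : |ξ - t| ≤ C * (1 - r / Q)⁻¹ * ((r / Q) ^ c) ^ x := by
    have h1 : t = ∑ m ∈ Finset.range ((c + 1) * x + 1), σ (a m) / Q ^ m := by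
      refine Finset.sum_subset (Finset.range_subset_range.2 (by nlinarith)) fun m hm hm' => ?_
      rw [Finset.mem_range] at hm hm'
      rw [hcon m (by omega) (by omega)]
      simp
    rw [h1]
    refine (abs_sub_sum_range_le_of_hasSum (C := C) (by positivity) hrq (fun m => ?_) hξ _).trans ?_
    · simpa using hh (Complex.ofRealHom.comp σ) m
    · rw [← pow_mul]
      have : 0 ≤ (1 - r / Q)⁻¹ := inv_nonneg.2 (by linarith)
      refine mul_le_mul_of_nonneg_left ?_ (by positivity)
      exact pow_le_pow_of_le_one hρ0.le hρ1.le (by nlinarith)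
  have hlow := le_abs_of_isIntegral_mul (σ := σ) hb
    (isIntegral_mul_truncNumerator hqi hai hbi x)
    (fun h0 => hx1 (by
      have h1 := map_truncNumerator (σ := σ) (a := a) P hQ0.ne' x
      rw [h0, map_zero] at h1
      exact (mul_eq_zero.1 h1.symm).resolve_left (pow_pos hQ0 _).ne'))
    (B := coeffBound P * (C * (2 * r) ^ x) ^ D)
    (by
      have h1 : 1 ≤ (2 * r) ^ x := one_le_pow₀ (by linarith)
      have h2 : 1 ≤ (C * (2 * r) ^ x) ^ D := one_le_pow₀ (by nlinarith)
      nlinarith)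
    fun φ hφ => norm_truncNumerator_le P φ (hqc φ hφ) hC hr (hh φ) x
  rw [map_truncNumerator P hQ0.ne', abs_mul,
    abs_of_pos (pow_pos hQ0 _ : 0 < σ q ^ (P.natDegree * x)),
    inv_le_iff_one_le_mul₀ (by have : 0 < |(b : ℝ)| := abs_pos.2 (by exact_mod_cast hb)
                               positivity)] at hlow
  have ht0 : t ∈ Set.Icc 0 ξ := ⟨Finset.sum_nonneg fun m _ => hpt m, (hlt x).le⟩
  have hup := (hL t ht0).trans (mul_le_mul_of_nonneg_left htail hL0)
  have hA0 : 0 ≤ A := by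
    have : 0 ≤ (1 - r / Q)⁻¹ := inv_nonneg.2 (by linarith)
    positivity
  refine absurd hlow (not_le.2 ?_)
  calc _ ≤ σ q ^ (P.natDegree * x) * (L * (C * (1 - r / Q)⁻¹ * ((r / Q) ^ c) ^ x)) *
        (|(b : ℝ)| * (|(b : ℝ)| * (coeffBound P * (C * (2 * r) ^ x) ^ D)) ^ d) := by gcongr
    _ = A * (E * (r / Q) ^ c) ^ x := by
      rw [hA, hE]
      simp only [mul_pow, ← pow_mul]
      ring
    _ ≤ A * (1 / 2 : ℝ) ^ x := by
      gcongr
      calc E * (r / Q) ^ c ≤ E * (2 * E)⁻¹ := by gcongr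
        _ = 1 / 2 := by field_simp
    _ < 1 := hx2

theorem exists_ne_zero_le (hq : 1 < σ q) (hqi : IsIntegral ℤ q)
    (hqc : ∀ φ : K →+* ℂ, φ ≠ Complex.ofRealHom.comp σ → ‖φ q‖ ≤ 1)
    (hai : ∀ m, IsIntegral ℤ (a m)) (ha : ∀ m, 0 ≤ σ (a m)) (hinf : {m | a m ≠ 0}.Infinite)
    {C r : ℝ} (hC : 1 ≤ C) (hr : 1 ≤ r) (hrq : r < σ q)
    (hh : ∀ φ : K →+* ℂ, ∀ m, ‖φ (a m)‖ ≤ C * r ^ m) {ξ : ℝ}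
    (hξ : HasSum (fun m => σ (a m) / σ q ^ m) ξ) {P : K[X]} (hP0 : P ≠ 0)
    (hP : P.eval₂ σ ξ = 0) :
    ∃ c L₀ : ℕ, 1 ≤ L₀ ∧ ∀ L ≥ L₀, ∃ s ∈ {m | a m ≠ 0}, s ≤ L ∧ L ≤ c * s := by
  obtain ⟨c, x₀, hc, h⟩ := exists_ne_zero_between hq hqi hqc hai ha hinf hC hr hrq hh hξ hP0 hP
  refine ⟨c, c * x₀ + 1, by omega, fun L hL => ?_⟩
  have hx : x₀ ≤ L / c := (Nat.le_div_iff_mul_le hc).2 (by rw [mul_comm]; omega)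
  -- The point found lies beyond ⌊L / c⌋ and not beyond c ⌊L / c⌋ ≤ L.
  obtain ⟨y, hy1, hy2, hy3⟩ := h (L / c) hx
  refine ⟨y, hy3, hy2.trans (Nat.mul_div_le L c), ?_⟩
  have h1 := Nat.div_add_mod L c
  have h2 := Nat.mod_lt L hc
  have h3 : c * (L / c + 1) ≤ c * y := Nat.mul_le_mul_left c hy1
  rw [mul_add, mul_one] at h3
  omega

end Liouville

/-! ### Lower bound for the number of nonzero digits -/

section DigitCount

open Polynomial

/-- Supplies the window length W. As log H ≥ log 2, constants and rounding are absorbed into log H.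
-/
theorem exists_pow_gt_of_le_log {Q A : ℝ} (hQ : 1 < Q) (hA : 1 ≤ A) (E : ℕ) :
    ∃ C : ℝ, 0 ≤ C ∧ ∀ H : ℝ, 2 ≤ H → ∃ W : ℕ, 1 ≤ W ∧ A * H ^ E < Q ^ W ∧ W ≤ C * Real.log H := by
  have hlQ : 0 < Real.log Q := Real.log_pos hQ
  have hl2 : 0 < Real.log 2 := Real.log_pos (by norm_num)
  have hlA : 0 ≤ Real.log A := Real.log_nonneg hA
  refine ⟨(Real.log A / Real.log 2 + E) / Real.log Q + 1 / Real.log 2, by positivity,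
    fun H hH => ?_⟩
  have hlH : Real.log 2 ≤ Real.log H := Real.log_le_log (by norm_num) hH
  have hH0 : 0 < H := by linarith
  have hlog : Real.log (A * H ^ E) = Real.log A + E * Real.log H := by
    rw [Real.log_mul (by positivity) (by positivity), Real.log_pow]
  have hlH0 : 0 < Real.log H := hl2.trans_le hlH
  refine ⟨⌊Real.log (A * H ^ E) / Real.log Q⌋₊ + 1, by omega, ?_, ?_⟩
  · rw [← Real.log_lt_log_iff (by positivity) (by positivity), Real.log_pow, ← div_lt_iff₀ hlQ]
    push_cast
    exact Nat.lt_floor_add_one _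
  · rw [hlog]
    push_cast
    have h1 : (⌊(Real.log A + E * Real.log H) / Real.log Q⌋₊ : ℝ) ≤
        (Real.log A + E * Real.log H) / Real.log Q := Nat.floor_le (by positivity)
    have h2 : 1 ≤ Real.log H / Real.log 2 := (one_le_div hl2).2 hlH
    have h3 : Real.log A ≤ Real.log A * (Real.log H / Real.log 2) := le_mul_of_one_le_right hlA h2
    calc _ ≤ (Real.log A + E * Real.log H) / Real.log Q + Real.log H / Real.log 2 := by linarith
      _ ≤ (Real.log A * (Real.log H / Real.log 2) + E * Real.log H) / Real.log Q +
          Real.log H / Real.log 2 := by gcongr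
      _ = _ := by ring

variable {K : Type*} [Field K] {σ : K →+* ℝ} {a : ℕ → K} {q : K}

/-- By nesting of supports all lower powers vanish at m too, leaving the leading term of the monic
P. -/
theorem polyCoeff_eq_of_coeff_eq_zero {P : K[X]} (hP : P.Monic) (hD : 1 ≤ P.natDegree)
    (ha : ∀ m, 0 ≤ σ (a m)) (h0 : a 0 ≠ 0) {m : ℕ}
    (hm : PowerSeries.coeff m (PowerSeries.mk a ^ (P.natDegree - 1)) = 0) :
    polyCoeff P a m = PowerSeries.coeff m (PowerSeries.mk a ^ P.natDegree) := by
  rw [polyCoeff, Finset.sum_range_succ, hP.coeff_natDegree, one_mul, add_eq_right]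
  refine Finset.sum_eq_zero fun j hj => ?_
  rw [Finset.mem_range] at hj
  have : PowerSeries.coeff m (PowerSeries.mk a ^ j) = 0 := by
    by_contra h
    exact coeff_mk_pow_ne_zero_of_le ha h0 (by omega) h hm
  rw [this, mul_zero]

/-- The direct bound is exponential in R. Going back from N to R ≤ N / p divides the value at N by Q
^ (N - R) ≥ r ^ N, so only a constant survives of it. -/
theorem abs_polyTail_le_of_mul_le {P : K[X]} (hq : 1 < σ q) {r C F : ℝ} (hr : 0 < r)
    (hC : 0 ≤ C) (hF0 : 0 ≤ F) {N p R : ℕ} (hp : σ q ≤ (σ q / r) ^ p) (hrq : r < σ q)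
    (htail : |σ (polyTail q P a N)| ≤ C * r ^ N) (hF : ∀ m ≤ N, |σ (polyCoeff P a m)| ≤ F)
    (hR : R ≤ N / p) : |σ (polyTail q P a R)| ≤ N * F + C := by
  have hRN : R ≤ N := hR.trans (Nat.div_le_self _ _)
  set Q := σ q with hQ
  have hQ0 : 0 < Q := by positivity
  have hrec : ∀ R, σ (polyTail q P a (R + 1)) =
      Q * σ (polyTail q P a R) - σ (polyCoeff P a (R + 1)) := fun R => by
    rw [polyTail_succ, map_sub, map_mul]
  have h1 := pow_mul_abs_recurrence_le (y := fun R => σ (polyTail q P a R))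
    (f := fun m => σ (polyCoeff P a m)) (R := R) (t := N - R) hq hrec hF0
    (fun m hm => hF m (by omega))
  rw [show R + (N - R) = N by omega] at h1
  have h2 : r ^ N ≤ Q ^ (N - R) := by
    have h3 : Q ^ R ≤ (Q / r) ^ N := by
      calc Q ^ R ≤ ((Q / r) ^ p) ^ R := by gcongr
        _ = (Q / r) ^ (p * R) := (pow_mul _ _ _).symm
        _ ≤ (Q / r) ^ N := by
          refine pow_le_pow_right₀ ((one_le_div hr).2 hrq.le) ?_
          exact (Nat.mul_le_mul_left p hR).trans (Nat.mul_div_le N p)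
    rw [div_pow, le_div_iff₀ (by positivity)] at h3
    rw [pow_sub₀ _ hQ0.ne' hRN, ← div_eq_mul_inv, le_div_iff₀ (by positivity)]
    linarith
  have h4 : (0 : ℝ) < Q ^ (N - R) := by positivity
  have h5 : ((N - R : ℕ) : ℝ) ≤ N := by exact_mod_cast Nat.sub_le N R
  refine le_of_mul_le_mul_left ?_ h4
  calc _ ≤ _ := h1
    _ ≤ Q ^ (N - R) * (N * F) + C * Q ^ (N - R) := by
      gcongr
      exact htail.trans (by gcongr)
    _ = _ := by ring

variable [NumberField K]

open Classical in
/-- If `∑ a n / q ^ n` is a root of a monic polynomial of degree `D`, then the number of nonzero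
digits up to `N` is at least of order `(N / log H) ^ (1 / D)`, where `H` bounds the conjugates of
the digits up to `N`. -/
theorem exists_le_card_pow_mul_log (hq : 1 < σ q) (hqi : IsIntegral ℤ q)
    (hqc : ∀ φ : K →+* ℂ, φ ≠ Complex.ofRealHom.comp σ → ‖φ q‖ ≤ 1)
    (hai : ∀ m, IsIntegral ℤ (a m)) (ha : ∀ m, 0 ≤ σ (a m)) (hinf : {m | a m ≠ 0}.Infinite)
    (h0 : a 0 ≠ 0) {C r : ℝ} (hC : 1 ≤ C) (hr : 1 ≤ r) (hrq : r < σ q)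
    (hh : ∀ φ : K →+* ℂ, ∀ m, ‖φ (a m)‖ ≤ C * r ^ m) {ξ : ℝ}
    (hξ : HasSum (fun m => σ (a m) / σ q ^ m) ξ) {P : K[X]} (hP : P.Monic) (hD : 1 ≤ P.natDegree)
    (hPξ : P.eval₂ σ ξ = 0) :
    ∃ C' : ℝ, ∀ (N : ℕ) (H : ℝ), 2 ≤ H → (N : ℝ) ≤ H →
      (∀ φ : K →+* ℂ, ∀ i ≤ N, ‖φ (a i)‖ ≤ H) →
      (N : ℝ) ≤ C' * ((((Finset.range (N + 1)).filter fun m => a m ≠ 0).card : ℝ) ^ P.natDegree *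
        Real.log H) := by
  obtain ⟨b, hb, hbi⟩ := exists_int_mul_coeff_isIntegral P
  obtain ⟨c, L₀, hL₀, hS⟩ := exists_ne_zero_le hq hqi hqc hai ha hinf hC hr hrq hh hξ hP.ne_zero hPξ
  -- The digit series must converge at a radius strictly between r and q, so that its remainder at q
  -- decays.
  obtain ⟨s, hrs, hsq⟩ := exists_between hrq
  have hs0 : 0 < s := by linarith
  have hs : Summable fun m => σ (a m) / s ^ m := by
    refine Summable.of_nonneg_of_le (fun m => div_nonneg (ha m) (by positivity)) (fun m => ?_)
      ((summable_geometric_of_lt_one (by positivity) ((div_lt_one hs0).2 hrs)).mul_left C)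
    rw [div_pow, ← mul_div_assoc]
    gcongr
    have h1 : ‖(Complex.ofRealHom.comp σ) (a m)‖ ≤ C * r ^ m := hh _ m
    simpa [abs_of_nonneg (ha m)] using h1
  obtain ⟨C₃, hC₃, htail⟩ := exists_abs_polyTail_le ha hs0 hsq hs hξ hPξ
  set Q := σ q with hQ
  set D := P.natDegree with hDdef
  set d := Module.finrank ℚ K
  have hCP := one_le_coeffBound P
  obtain ⟨p, hp⟩ := pow_unbounded_of_one_lt Q ((one_lt_div hs0).2 hsq)
  have hp1 : 0 < p := Nat.pos_of_ne_zero fun h => by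
    rw [h, pow_zero] at hp
    linarith
  have hb1 : (1 : ℝ) ≤ |(b : ℝ)| := by exact_mod_cast Int.one_le_abs hb
  set B₀ : ℝ := 2 ^ (D + 1) * coeffBound P with hB₀
  have hB₀1 : 1 ≤ B₀ := by
    have : (1 : ℝ) ≤ 2 ^ (D + 1) := one_le_pow₀ (by norm_num)
    nlinarith
  have hA1 : 1 ≤ (B₀ + C₃) * (|(b : ℝ)| * (|(b : ℝ)| * B₀) ^ d) := by
    have h1 : 1 ≤ (|(b : ℝ)| * B₀) ^ d := one_le_pow₀ (by nlinarith)
    have h2 : 1 ≤ |(b : ℝ)| * (|(b : ℝ)| * B₀) ^ d := by nlinarith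
    nlinarith
  -- The ratio Γ / δ involves d + 1 factors of size H ^ (2 D + 1): one from Γ and d from the norm
  -- bound.
  obtain ⟨C₅, hC₅, hW⟩ := exists_pow_gt_of_le_log hq hA1 ((2 * D + 1) * (d + 1))
  refine ⟨p * (2 * c + L₀ + 2) * C₅, fun N H hH hNH hNa => ?_⟩
  obtain ⟨W, hW1, hWlt, hWle⟩ := hW H hH
  have hH1 : 1 ≤ H := by linarith
  set F : ℝ := coeffBound P * ((N + 1) * H) ^ D with hF
  have hF1 : 1 ≤ F := by
    have h1 : 1 ≤ ((N + 1) * H) ^ D := one_le_pow₀ (by nlinarith [Nat.cast_nonneg (α := ℝ) N])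
    nlinarith
  have hN0 : (0 : ℝ) ≤ N := Nat.cast_nonneg N
  have hB1 : 1 ≤ (N + 1) * F := by nlinarith
  have hBle : (N + 1) * F ≤ B₀ * H ^ (2 * D + 1) := by
    calc (N + 1) * F ≤ (2 * H) * (coeffBound P * ((2 * H) * H) ^ D) := by
          rw [hF]
          gcongr <;> linarith
      _ = _ := by rw [hB₀, mul_pow, mul_pow, pow_succ, pow_succ, pow_mul']; ring
  have hFm : ∀ m ≤ N, |σ (polyCoeff P a m)| ≤ F := fun m hm => by
    have := norm_polyCoeff_le P (Complex.ofRealHom.comp σ) hH1 (hNa _) hm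
    simpa using this
  have hlow : ∀ R ≤ N / p, σ (polyTail q P a R) ≠ 0 →
      (|(b : ℝ)| * (|(b : ℝ)| * ((N + 1) * F)) ^ d)⁻¹ ≤ |σ (polyTail q P a R)| := fun R hR hne =>
    le_abs_of_isIntegral_mul hb (isIntegral_mul_polyTail hqi hai hbi R)
      (fun h => hne (by rw [h, map_zero])) hB1 fun φ hφ =>
      norm_polyTail_le P φ (hqc φ hφ) hH1 (hNa φ) (hR.trans (Nat.div_le_self _ _))
  have hup : ∀ R ≤ N / p, |σ (polyTail q P a R)| ≤ N * F + C₃ := fun R hR =>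
    abs_polyTail_le_of_mul_le hq hs0 hC₃ (by linarith) hp.le hsq (htail N) hFm hR
  have hΓ : N * F + C₃ < (|(b : ℝ)| * (|(b : ℝ)| * ((N + 1) * F)) ^ d)⁻¹ * Q ^ W := by
    rw [inv_mul_eq_div, lt_div_iff₀ (by positivity)]
    refine lt_of_le_of_lt ?_ hWlt
    have hHp : 1 ≤ H ^ (2 * D + 1) := one_le_pow₀ hH1
    calc _ ≤ ((B₀ + C₃) * H ^ (2 * D + 1)) *
          (|(b : ℝ)| * (|(b : ℝ)| * (B₀ * H ^ (2 * D + 1))) ^ d) := by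
          gcongr
          nlinarith
      _ = _ := by
        rw [pow_mul, pow_succ _ d, ← mul_assoc |(b : ℝ)| B₀, mul_pow (|(b : ℝ)| * B₀)]
        ring
  have key := card_le_of_recurrence (y := fun R => σ (polyTail q P a R))
    (f := fun m => σ (polyCoeff P a m)) (M := N / p)
    (S := {m | a m ≠ 0})
    (S₁ := {m | PowerSeries.coeff m (PowerSeries.mk a ^ (D - 1)) ≠ 0})
    (S₂ := {m | PowerSeries.coeff m (PowerSeries.mk a ^ D) ≠ 0}) hq
    (fun R => by simp only [polyTail_succ, map_sub, map_mul]; rfl)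
    hlow hup hΓ
    (coeff_mk_pow_ne_zero_of_le ha h0 (Nat.zero_le _) (by simp))
    (fun m hm hm' => by
      simp only [Set.mem_ofPred_eq, not_not] at hm'
      rw [polyCoeff_eq_of_coeff_eq_zero hP hD ha h0 hm']
      exact (coeff_mk_pow_nonneg ha _ _).lt_of_ne' (by simpa using hm))
    (fun m hm => by
      simp only [Set.mem_ofPred_eq, not_not] at hm
      rw [polyCoeff_eq_of_coeff_eq_zero hP hD ha h0, hm, map_zero]
      by_contra h
      exact coeff_mk_pow_ne_zero_of_le ha h0 (Nat.sub_le _ _) h hm)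
    (fun u hu s hs => by
      have := coeff_mk_pow_succ_ne_zero ha hu hs
      rwa [Nat.sub_add_cancel hD] at this)
    hS hL₀
  simp only [Set.mem_ofPred_eq] at key
  set k := ((Finset.range (N + 1)).filter fun m => a m ≠ 0).card with hk
  have hMN : N / p + 1 ≤ N + 1 := by have := Nat.div_le_self N p; omega
  have hkM : ((Finset.range (N / p + 1)).filter fun m => a m ≠ 0).card ≤ k :=
    Finset.card_le_card (Finset.filter_subset_filter _ (Finset.range_subset_range.2 hMN))
  have hk1 : 1 ≤ k := Finset.card_pos.2 ⟨0, by simp [h0]⟩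
  have hT := (card_support_mk_pow_le a D (N / p + 1)).trans (Nat.pow_le_pow_left hkM D)
  have hU := (card_support_mk_pow_le a (D - 1) (N / p + 1)).trans
    ((Nat.pow_le_pow_left hkM (D - 1)).trans (Nat.pow_le_pow_right hk1 (Nat.sub_le D 1)))
  have hn1 : 1 ≤ k ^ D := Nat.one_le_pow _ _ hk1
  have hmain : N / p + 1 ≤ (2 * c + L₀ + 2) * (W * k ^ D) := by
    have hWn : W ≤ W * k ^ D := Nat.le_mul_of_pos_right _ hn1
    have hnW : k ^ D ≤ W * k ^ D := Nat.le_mul_of_pos_left _ hW1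
    calc _ ≤ _ := key
      _ ≤ c * (W * k ^ D + W) + (W + L₀ + 1) * k ^ D := by gcongr
      _ = c * (W * k ^ D + W) + W * k ^ D + (L₀ + 1) * k ^ D := by ring
      _ ≤ c * (W * k ^ D + W * k ^ D) + W * k ^ D + (L₀ + 1) * (W * k ^ D) := by gcongr
      _ = _ := by ring
  have hNp : N ≤ p * (N / p + 1) := (Nat.lt_mul_div_succ N hp1).le
  have hfin : N ≤ p * ((2 * c + L₀ + 2) * (W * k ^ D)) := hNp.trans (Nat.mul_le_mul_left p hmain)
  calc (N : ℝ) ≤ p * ((2 * c + L₀ + 2) * (W * (k : ℝ) ^ D)) := by exact_mod_cast hfin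
    _ ≤ p * ((2 * c + L₀ + 2) * ((C₅ * Real.log H) * (k : ℝ) ^ D)) := by gcongr
    _ = _ := by ring

end DigitCount

/-! ### Application to ℚ(q) -/

open IntermediateField

theorem algebraicHouse_nonneg (α : ℝ) : 0 ≤ algebraicHouse α :=
  Real.sSup_nonneg (by rintro _ ⟨z, _, rfl⟩; exact norm_nonneg z)

theorem one_lt_and_isIntegral_and_norm_le_of_pisot_or_salem {q : ℝ}
    (hq : IsPisotNumber q ∨ IsSalemNumber q) :
    1 < q ∧ IsIntegral ℤ q ∧ ∀ z ∈ galoisConjugates q, z ≠ (q : ℂ) → ‖z‖ ≤ 1 := by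
  rcases hq with ⟨h1, h2, h3⟩ | ⟨h1, h2, h3, _⟩
  · exact ⟨h1, h2, fun z hz hne => (h3 z hz hne).le⟩
  · exact ⟨h1, h2, h3⟩

/-- An embedding of ℚ(q) is determined by the image of q, so any other one sends q to a different
conjugate. -/
theorem norm_embedding_gen_le_one {q : ℝ} [NumberField ℚ⟮q⟯]
    (h : ∀ z ∈ galoisConjugates q, z ≠ (q : ℂ) → ‖z‖ ≤ 1) (φ : ℚ⟮q⟯ →+* ℂ)
    (hφ : φ ≠ Complex.ofRealHom.comp (algebraMap ℚ⟮q⟯ ℝ)) : ‖φ (AdjoinSimple.gen ℚ q)‖ ≤ 1 := by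
  refine h _ ?_ fun he => hφ ?_
  · have h0 : minpoly ℚ q = minpoly ℚ (AdjoinSimple.gen ℚ q) := (minpoly_gen ℚ q).symm
    rw [galoisConjugates, h0, ← NumberField.Embeddings.range_eval_eq_rootSet_minpoly]
    exact ⟨φ, rfl⟩
  · have hext : φ.toRatAlgHom =
        (Complex.ofRealHom.comp (algebraMap ℚ⟮q⟯ ℝ)).toRatAlgHom := by
      refine adjoin_algHom_ext ℚ fun x hx => ?_
      obtain rfl : x = q := hx
      exact he
    exact RingHom.ext fun y => congrArg (fun ψ : ℚ⟮q⟯ →ₐ[ℚ] ℂ => ψ y) hext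

theorem exists_algebraicHouse_le {q : ℝ} (hq : 1 < q) {a : ℕ → ℝ} {n : ℕ → ℕ}
    (hn_image : n '' Set.Ici 1 = nonzeroIndices a)
    (h_coeff : Filter.limsup
      (fun k : ℕ => ((algebraicHouse (a (n k)) ^ (1 / (n k : ℝ)) : ℝ) : EReal)) Filter.atTop
        < (q : EReal)) :
    ∃ C r : ℝ, 1 ≤ C ∧ 1 ≤ r ∧ r < q ∧
      ∀ m ∈ nonzeroIndices a, algebraicHouse (a m) ≤ C * r ^ m := by
  obtain ⟨s, hs1, hs2⟩ := EReal.lt_iff_exists_real_btwn.1 h_coeff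
  obtain ⟨k₀, hk₀⟩ := Filter.eventually_atTop.1 (Filter.eventually_lt_of_limsup_lt hs1)
  have hnn : ∀ k ∈ Finset.range k₀, 0 ≤ algebraicHouse (a (n k)) :=
    fun k _ => algebraicHouse_nonneg _
  have hsum := Finset.sum_nonneg hnn
  -- The sum covers the finitely many indices about which the limsup says nothing.
  refine ⟨1 + ∑ k ∈ Finset.range k₀, algebraicHouse (a (n k)), max s 1, by linarith,
    le_max_right _ _, max_lt (by exact_mod_cast hs2) hq, fun m hm => ?_⟩
  have hm1 := hm.1
  rw [← hn_image] at hm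
  obtain ⟨k, -, rfl⟩ := hm
  have hr1 : 1 ≤ max s 1 ^ n k := one_le_pow₀ (le_max_right _ _)
  by_cases hk : k < k₀
  · have := Finset.single_le_sum hnn (Finset.mem_range.2 hk)
    nlinarith
  · have h1 : algebraicHouse (a (n k)) ^ (1 / (n k : ℝ)) < s := by
      exact_mod_cast hk₀ k (by omega)
    have h2 : algebraicHouse (a (n k)) ≤ max s 1 ^ n k := by
      calc algebraicHouse (a (n k)) = (algebraicHouse (a (n k)) ^ (1 / (n k : ℝ))) ^ n k := by
            rw [one_div, Real.rpow_inv_natCast_pow (algebraicHouse_nonneg _) (by omega)]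
        _ ≤ max s 1 ^ n k := by
          have := Real.rpow_nonneg (algebraicHouse_nonneg (a (n k))) (1 / (n k : ℝ))
          gcongr
          exact h1.le.trans (le_max_left _ _)
    nlinarith

theorem le_houseMax (a : ℕ → ℝ) (N : ℕ) : (N : ℝ) ≤ houseMax a N :=
  Finset.le_max' _ _ (Finset.mem_insert_self _ _)

theorem algebraicHouse_le_houseMax (a : ℕ → ℝ) {m N : ℕ} (h1 : 1 ≤ m) (h2 : m ≤ N) :
    algebraicHouse (a m) ≤ houseMax a N :=
  Finset.le_max' _ _ (Finset.mem_insert_of_mem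
    (Finset.mem_image_of_mem (fun m => algebraicHouse (a m)) (Finset.mem_Icc.2 ⟨h1, h2⟩)))

theorem le_of_strictMonoOn_Ici_one {n : ℕ → ℕ} (hn : StrictMonoOn n (Set.Ici 1))
    (h1 : 1 ≤ n 1) {k : ℕ} (hk : 1 ≤ k) : k ≤ n k := by
  induction k, hk using Nat.le_induction with
  | base => exact h1
  | succ k hk ih =>
    have := hn (Set.mem_Ici.2 hk) (Set.mem_Ici.2 (by omega : 1 ≤ k + 1)) (Nat.lt_succ_self k)
    omega

theorem mainTheorem5 (q : ℝ) (hq : IsPisotNumber q ∨ IsSalemNumber q)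
    (a : ℕ → ℝ)
    (ha_int : ∀ m : ℕ, 1 ≤ m → a m ∈ IntermediateField.adjoin ℚ ({q} : Set ℝ) ∧ IsIntegral ℤ (a m))
    (ha_nonneg : ∀ m : ℕ, 1 ≤ m → 0 ≤ a m)
    (ha_inf : (nonzeroIndices a).Infinite)
    -- `n 1 < n 2 < ⋯` is the enumeration of the indices of the nonzero terms
    (n : ℕ → ℕ)
    (hn_mono : StrictMonoOn n (Set.Ici 1))
    (hn_image : n '' Set.Ici 1 = nonzeroIndices a)
    (h_coeff : Filter.limsup
      (fun k : ℕ => ((algebraicHouse (a (n k)) ^ (1 / (n k : ℝ)) : ℝ) : EReal)) Filter.atTop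
        < (q : EReal))
    (l : ℕ) (hl : 1 ≤ l)
    (h_sparse : Filter.limsup
      (fun k : ℕ => (((n k : ℝ) / ((k : ℝ) ^ l * Real.log (houseMax a (n k))) : ℝ) : EReal))
        Filter.atTop = ⊤) :
    ∃ ξ : ℝ, HasSum (fun m : ℕ => a (m + 1) / q ^ (m + 1)) ξ ∧
      (Transcendental ℚ ξ ∨
        (IsAlgebraic (IntermediateField.adjoin ℚ ({q} : Set ℝ)) ξ ∧
          l + 1 ≤ (minpoly (IntermediateField.adjoin ℚ ({q} : Set ℝ)) ξ).natDegree)) := by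
  classical
  obtain ⟨hq1, hqi, hqc⟩ := one_lt_and_isIntegral_and_norm_le_of_pisot_or_salem hq
  have hfin : FiniteDimensional ℚ ℚ⟮q⟯ := adjoin.finiteDimensional hqi.tower_top
  have : NumberField ℚ⟮q⟯ := ⟨⟩
  obtain ⟨C, r, hC, hr, hrq, hhouse⟩ := exists_algebraicHouse_le hq1 hn_image h_coeff
  -- The digit 1 at index 0 replaces the unused value there and raises the sum by 1.
  let d : ℕ → ℚ⟮q⟯ := fun m => if h : 1 ≤ m then ⟨a m, (ha_int m h).1⟩ else 1
  have hd : ∀ m, 1 ≤ m → algebraMap ℚ⟮q⟯ ℝ (d m) = a m := fun m hm => by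
    simp only [d, dif_pos hm]; rfl
  have hd0 : d 0 = 1 := rfl
  have hdi : ∀ m, IsIntegral ℤ (d m) := fun m => by
    rcases Nat.eq_zero_or_pos m with rfl | hm
    · rw [hd0]; exact isIntegral_one
    · rw [← isIntegral_algebraMap_iff (B := ℝ) (algebraMap ℚ⟮q⟯ ℝ).injective, hd m hm]
      exact (ha_int m hm).2
  have hdn : ∀ m, 0 ≤ algebraMap ℚ⟮q⟯ ℝ (d m) := fun m => by
    rcases Nat.eq_zero_or_pos m with rfl | hm
    · rw [hd0, map_one]; exact zero_le_one
    · rw [hd m hm]; exact ha_nonneg m hm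
  have hd_ne : ∀ m, 1 ≤ m → (d m ≠ 0 ↔ m ∈ nonzeroIndices a) := fun m hm => by
    rw [← map_ne_zero (algebraMap ℚ⟮q⟯ ℝ), hd m hm]
    exact ⟨fun h => ⟨hm, h⟩, fun h => h.2⟩
  have hφh : ∀ φ : ℚ⟮q⟯ →+* ℂ, ∀ m, 1 ≤ m → ‖φ (d m)‖ ≤ algebraicHouse (a m) := fun φ m hm => by
    rw [← hd m hm]
    exact (NumberField.norm_embedding_le_house _ φ).trans (algebraicHouse_eq_house _ _).ge
  have hh : ∀ φ : ℚ⟮q⟯ →+* ℂ, ∀ m, ‖φ (d m)‖ ≤ C * r ^ m := fun φ m => by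
    rcases Nat.eq_zero_or_pos m with rfl | hm
    · simpa [hd0] using hC
    · by_cases h0 : d m = 0
      · rw [h0, map_zero, norm_zero]; positivity
      · exact (hφh φ m hm).trans (hhouse m ((hd_ne m hm).1 h0))
  have hσq : algebraMap ℚ⟮q⟯ ℝ (AdjoinSimple.gen ℚ q) = q := AdjoinSimple.algebraMap_gen ℚ q
  have hsum : Summable fun m => algebraMap ℚ⟮q⟯ ℝ (d m) / q ^ m := by
    refine Summable.of_nonneg_of_le (fun m => div_nonneg (hdn m) (by positivity)) (fun m => ?_)
      ((summable_geometric_of_lt_one (by positivity)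
        ((div_lt_one (by linarith)).2 hrq)).mul_left C)
    rw [div_pow, ← mul_div_assoc]
    gcongr
    have h1 := hh (Complex.ofRealHom.comp (algebraMap ℚ⟮q⟯ ℝ)) m
    rw [RingHom.comp_apply, Complex.ofRealHom_eq_coe, Complex.norm_real,
      Real.norm_of_nonneg (hdn m)] at h1
    exact h1
  obtain ⟨x, hx⟩ := hsum
  have hξ : HasSum (fun m : ℕ => a (m + 1) / q ^ (m + 1)) (x - 1) := by
    have h1 := (hasSum_nat_add_iff' 1).2 hx
    simp only [Finset.sum_range_one, hd0, map_one, pow_zero, div_one] at h1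
    refine h1.congr_fun fun m => ?_
    rw [hd _ (by omega)]
  refine ⟨x - 1, hξ, or_iff_not_imp_left.2 fun htr => ?_⟩
  have halg : IsAlgebraic ℚ⟮q⟯ (x - 1) := (not_not.1 htr).tower_top ℚ⟮q⟯
  refine ⟨halg, ?_⟩
  by_contra! hdeg
  have hintegral : IsIntegral ℚ⟮q⟯ (x - 1) := halg.isIntegral
  have hn1 : 1 ≤ n 1 := by
    have : n 1 ∈ nonzeroIndices a := hn_image ▸ Set.mem_image_of_mem n (Set.mem_Ici.2 le_rfl)
    exact this.1
  -- Shifting the minimal polynomial of x - 1 gives a monic polynomial of the same degree vanishing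
  -- at x.
  have hPdeg : ((minpoly ℚ⟮q⟯ (x - 1)).comp (Polynomial.X - Polynomial.C 1)).natDegree =
      (minpoly ℚ⟮q⟯ (x - 1)).natDegree := by
    rw [Polynomial.natDegree_comp, Polynomial.natDegree_X_sub_C, mul_one]
  obtain ⟨C', hC'⟩ := exists_le_card_pow_mul_log (σ := algebraMap ℚ⟮q⟯ ℝ) (a := d)
    (q := AdjoinSimple.gen ℚ q) (ξ := x)
    (P := (minpoly ℚ⟮q⟯ (x - 1)).comp (Polynomial.X - Polynomial.C 1))
    (by rwa [hσq])
    (by rw [← isIntegral_algebraMap_iff (B := ℝ) (algebraMap ℚ⟮q⟯ ℝ).injective, hσq]; exact hqi)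
    (norm_embedding_gen_le_one hqc) hdi hdn
    (ha_inf.mono fun m hm => (hd_ne m hm.1).2 hm) (by rw [hd0]; exact one_ne_zero) hC hr
    (by rwa [hσq]) hh (by rwa [hσq]) ((minpoly.monic hintegral).comp_X_sub_C 1)
    (by rw [hPdeg]; exact minpoly.natDegree_pos hintegral)
    (by
      rw [← Polynomial.aeval_def, Polynomial.aeval_comp]
      simp)
  rw [hPdeg] at hC'
  set D := (minpoly ℚ⟮q⟯ (x - 1)).natDegree
  -- The factor 2 ^ D pays for counting index 0: k + 1 ≤ 2 k nonzero digits.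
  have hfreq := Filter.frequently_lt_of_lt_limsup (b := ((|C'| * 2 ^ D : ℝ) : EReal))
    (h := by rw [h_sparse]; exact EReal.coe_lt_top _)
  obtain ⟨k, hk, hk2⟩ := (hfreq.and_eventually (Filter.eventually_ge_atTop 2)).exists
  have hk' : |C'| * 2 ^ D < (n k : ℝ) / ((k : ℝ) ^ l * Real.log (houseMax a (n k))) := by
    exact_mod_cast hk
  have hkn : k ≤ n k := le_of_strictMonoOn_Ici_one hn_mono hn1 (by omega)
  have hH2 : 2 ≤ houseMax a (n k) :=
    le_trans (by exact_mod_cast hk2.trans hkn) (le_houseMax a (n k))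
  have hmain := hC' (n k) (houseMax a (n k)) hH2 (le_houseMax a (n k)) fun φ i hi => by
    rcases Nat.eq_zero_or_pos i with rfl | hi0
    · rw [hd0, map_one, norm_one]; linarith
    · exact (hφh φ i hi0).trans (algebraicHouse_le_houseMax a hi0 hi)
  have hcard : ((Finset.range (n k + 1)).filter fun m => d m ≠ 0).card ≤ 2 * k := by
    have hsub : ((Finset.range (n k + 1)).filter fun m => d m ≠ 0) ⊆
        insert 0 ((Finset.Icc 1 k).image n) := fun m hm => by
      obtain ⟨hm1, hm2⟩ := Finset.mem_filter.1 hm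
      rw [Finset.mem_range] at hm1
      rcases Nat.eq_zero_or_pos m with rfl | hm0
      · exact Finset.mem_insert_self _ _
      · have hmem := (hd_ne m hm0).1 hm2
        rw [← hn_image] at hmem
        obtain ⟨j, hj, rfl⟩ := hmem
        refine Finset.mem_insert_of_mem (Finset.mem_image_of_mem n (Finset.mem_Icc.2 ⟨hj, ?_⟩))
        exact (hn_mono.le_iff_le hj (Set.mem_Ici.2 (by omega))).1 (by omega)
    calc _ ≤ (insert 0 ((Finset.Icc 1 k).image n)).card := Finset.card_le_card hsub
      _ ≤ ((Finset.Icc 1 k).image n).card + 1 := Finset.card_insert_le _ _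
      _ ≤ (Finset.Icc 1 k).card + 1 := Nat.add_le_add_right Finset.card_image_le 1
      _ ≤ _ := by simp; omega
  have hlog : 0 < Real.log (houseMax a (n k)) := Real.log_pos (by linarith)
  have hk0 : (1 : ℝ) ≤ k := by exact_mod_cast (by omega : 1 ≤ k)
  rw [lt_div_iff₀ (by positivity)] at hk'
  refine absurd hk' (not_lt.2 ?_)
  calc (n k : ℝ) ≤ _ := hmain
    _ ≤ |C'| * (((2 * k : ℕ) : ℝ) ^ D * Real.log (houseMax a (n k))) := by
      gcongr
      · exact le_abs_self C'
      · convert! hcard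
    _ = |C'| * 2 ^ D * ((k : ℝ) ^ D * Real.log (houseMax a (n k))) := by
      push_cast; rw [mul_pow]; ring
    -- The assumed degree bound D ≤ l enters here.
    _ ≤ |C'| * 2 ^ D * ((k : ℝ) ^ l * Real.log (houseMax a (n k))) := by
      gcongr
      omega
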